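/- \textbf{Setting.} Let $N,J\ge 1$ and $L\le K:=\min\{n_T,n_R\}$. For $n=1,\dots,N$ let $\mathbf y_n=\mathbf H_n\mathbf B_n\mathbf s_n+\mathbf w_n$, where \begin{itemize} \item $\mathbf H_n\in\mathbb R^{n_R\times n_T}$ is a given channel matrix of full rank $K$, and $\mathbf B_n\in\mathbb R^{n_T\times L}$ is the precoder; \item the symbols $\mathbf s_n\in\mathbb R^L$ are i.i.d. over $n$, with an arbitrary law having independent components and $\mathbb E[\mathbf s_n\mathbf s_n^{T}]=\mathbf I_L$; \item $\mathbf w_n\sim\mathcal N(\mathbf 0,\mathbf I_{n_R})$ is independent of $\mathbf s_n$, and the pairs $(\mathbf s_n,\mathbf w_n)$ are independent over $n$. \end{itemize} Energy packets of sizes $E_1,\dots,E_J\ge 0$ arrive at the beginnings of the channel uses $1=e_1\le e_2\le\dots\le e_J\le N$. Let $\tau_j=\{n : e_j\le n<e_{j+1}\}$ (with $e_{J+1}=N+1$) be the pool of channel uses between two consecutive arrivals, and let $T_s>0$. Consider the problem $$\max_{\{\mathbf B_n\}_{n=1}^N}\ \sum_{j=1}^J\sum_{n\in\tau_j} I(\mathbf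 s_n;\mathbf y_n)\quad\text{s.t.}\quad T_s\sum_{j=1}^{\ell}\sum_{n\in\tau_j}\mathrm{Tr}(\mathbf B_n\mathbf B_n^{T})\le\sum_{j=1}^{\ell}E_j,\qquad \ell=1,\dots,J. \tag{P}$$ For each $n$ let $\mathbf U_{H_n}\in\mathbb R^{n_T\times L}$ be any matrix whose columns are orthonormal eigenvectors of the channel Gram matrix $\mathbf H_n^{T}\mathbf H_n$ belonging to its $L$ largest eigenvalues, counted with multiplicity. \textbf{Lemma.} The left singular vectors of the optimal precoders can be chosen to be the columns of $\mathbf U_{H_n}$, for every $n$. That is, (P) has an optimal solution of the form $$\mathbf B_n=\mathbf U_{H_n}\boldsymbol\Sigma_n\mathbf V_n^{T},\qquad n=1,\dots,N,$$ with $\boldsymbol\Sigma_n\in\mathbb R^{L\times L}$ diagonal with nonnegative entries and $\mathbf V_n\in\mathbb R^{L\times L}$ orthogonal. Moreover, for every optimal solution $\{\mathbf B_n^\star\}$ of (P) there is an optimal solution $\{\mathbf B_n\}$ of this form which, at every channel use $n$, has the same mutual information $I(\mathbf s_n;\mathbf y_n)$ as $\mathbf B_n^\star$ and satisfies $\mathrm{Tr}(\mathbf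 B_n\mathbf B_n^{T})\le\mathrm{Tr}(\mathbf B_n^\star\mathbf B_n^{\star T})$. -/

import Mathlib

open MeasureTheory ProbabilityTheory Matrix

noncomputable section

namespace EnergyHarvesting

/-- Mutual information (in nats) of two random variables: the Kullback-Leibler divergence of
their joint law from the product of their marginal laws. -/
def mutualInfo {Ω α β : Type*} [MeasurableSpace Ω] [MeasurableSpace α] [MeasurableSpace β]
    (μ : Measure Ω) (X : Ω → α) (Y : Ω → β) : ENNReal :=
  InformationTheory.klDiv (μ.map (fun ω => (X ω, Y ω))) ((μ.map X).prod (μ.map Y))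

/-- The received signal `y = H B s + w`. -/
def received {Ω : Type*} {nT nR L : ℕ} (H : Matrix (Fin nR) (Fin nT) ℝ)
    (B : Matrix (Fin nT) (Fin L) ℝ) (s : Ω → Fin L → ℝ) (w : Ω → Fin nR → ℝ) :
    Ω → Fin nR → ℝ :=
  fun ω => (H * B) *ᵥ s ω + w ω

/-- The `j`-th pool: the channel uses from the `j`-th energy arrival (included) up to the next
energy arrival (excluded). The `j`-th packet arrives at the beginning of channel use `e j`. -/
def pool {N J : ℕ} (e : Fin J → Fin N) (j : Fin J) : Finset (Fin N) :=
  Finset.univ.filter (fun n => e j ≤ n ∧ ∀ i : Fin J, j < i → n < e i)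

/-- The energy causality constraints: for each `ℓ`, the energy spent on average in the pools up to
the `ℓ`-th is at most the energy harvested in the packets up to the `ℓ`-th. -/
def IsFeasible {N J nT L : ℕ} (Ts : ℝ) (e : Fin J → Fin N) (E : Fin J → ℝ)
    (B : Fin N → Matrix (Fin nT) (Fin L) ℝ) : Prop :=
  ∀ l : Fin J, Ts * ∑ j ∈ Finset.Iic l, ∑ n ∈ pool e j, (B n * (B n)ᵀ).trace
    ≤ ∑ j ∈ Finset.Iic l, E j

/-- The objective: the total mutual information over all channel uses, pool by pool. -/
def totalInfo {Ω : Type*} [MeasurableSpace Ω] {N J nT nR L : ℕ} (μ : Measure Ω)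
    (s : Fin N → Ω → Fin L → ℝ) (w : Fin N → Ω → Fin nR → ℝ)
    (H : Fin N → Matrix (Fin nR) (Fin nT) ℝ) (e : Fin J → Fin N)
    (B : Fin N → Matrix (Fin nT) (Fin L) ℝ) : ENNReal :=
  ∑ j : Fin J, ∑ n ∈ pool e j, mutualInfo μ (s n) (received (H n) (B n) (s n) (w n))

/-- `B` solves the mutual information maximization problem under the energy causality
constraints. -/
def IsOptimal {Ω : Type*} [MeasurableSpace Ω] {N J nT nR L : ℕ} (μ : Measure Ω)
    (s : Fin N → Ω → Fin L → ℝ) (w : Fin N → Ω → Fin nR → ℝ)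
    (H : Fin N → Matrix (Fin nR) (Fin nT) ℝ) (Ts : ℝ) (e : Fin J → Fin N) (E : Fin J → ℝ)
    (B : Fin N → Matrix (Fin nT) (Fin L) ℝ) : Prop :=
  IsFeasible Ts e E B ∧
    ∀ B' : Fin N → Matrix (Fin nT) (Fin L) ℝ, IsFeasible Ts e E B' →
      totalInfo μ s w H e B' ≤ totalInfo μ s w H e B

/-- The columns of `U` are orthonormal eigenvectors of the symmetric matrix `G`, belonging to its
`L` largest eigenvalues counted with multiplicity: no eigenvector orthogonal to all of them has
an eigenvalue larger than one of theirs. -/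
def IsTopEigenvectors {m L : ℕ} (G : Matrix (Fin m) (Fin m) ℝ)
    (U : Matrix (Fin m) (Fin L) ℝ) : Prop :=
  Uᵀ * U = 1 ∧ ∃ ev : Fin L → ℝ,
    (∀ k, G *ᵥ U.col k = ev k • U.col k) ∧
    ∀ (v : Fin m → ℝ) (a : ℝ), v ≠ 0 → G *ᵥ v = a • v → Uᵀ *ᵥ v = 0 → ∀ k, a ≤ ev k

/-- `B` has a singular value decomposition `B = U Σ Vᵀ` whose left singular vectors are the columns
of the (semi-unitary) matrix `U`. -/
def HasLeftSingularVectors {m L : ℕ} (B U : Matrix (Fin m) (Fin L) ℝ) : Prop :=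
  Uᵀ * U = 1 ∧ ∃ (σ : Fin L → ℝ) (V : Matrix (Fin L) (Fin L) ℝ),
    (∀ k, 0 ≤ σ k) ∧ V ∈ Matrix.orthogonalGroup (Fin L) ℝ ∧ B = U * Matrix.diagonal σ * Vᵀ

end EnergyHarvesting

end

/-! The channel uses decouple. Write `G = HᵀH` for one of them. Its mutual information depends on
`B` only through `BᵀGB`: if `HB` and `HB'` have the same Gram matrix, then `HB' = QHB` with `Q`
orthogonal (`exists_orthogonal_mul_eq`), and standard Gaussian noise is invariant under `Q`
(`gaussianInfo_orthogonal_mul`). It therefore suffices to realise a given `BᵀGB` with the least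
energy using the left singular vectors `U`; replacing `B` by that precoder keeps the objective and
the energy constraints.

Diagonalise `BᵀGB = V diag(d) Vᵀ`, ordering `d` like the top eigenvalues `ev` of `G`, which are
positive by the rank hypothesis. Then `U diag(√(d/ev)) Vᵀ` has the same `G`-Gram matrix and energy
`∑ d/ev`. This is minimal (`sum_div_le_trace`): the columns of `BV` with `d k > 0`, divided by `√(d
k)`, are `G`-orthonormal; any `q` such vectors have total squared length at least the sum of the
inverses of the `q` largest eigenvalues (`sum_inv_le_sum_dotProduct`), and Abel summation against
the decreasing weights `d` gives the bound.

An optimum exists because the feasible set is compact (`isCompact_isFeasible`) and the mutual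
information, as a Gaussian integral, is continuous in the channel matrix by dominated convergence
(`continuous_gaussianInfo`). -/

noncomputable section

namespace EnergyHarvesting

/-! ### Top eigenvectors and a Ky Fan type energy bound -/

section TopEigenvectors

/-- Abel summation: a sum weighted by an antitone nonnegative sequence is nonnegative as soon as
the partial sums are nonnegative wherever the weight is positive. -/
lemma mul_sum_range_le_sum_range_mul (d x : ℕ → ℝ) (hd : ∀ k, 0 ≤ d k) (hanti : Antitone d) :
    ∀ n : ℕ, (∀ m < n, 0 < d m → 0 ≤ ∑ k ∈ Finset.range (m + 1), x k) →
      d n * ∑ k ∈ Finset.range n, x k ≤ ∑ k ∈ Finset.range n, d k * x k := by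
  intro n
  induction n with
  | zero => intro _; simp
  | succ n ih =>
    intro h
    have ih' := ih fun m hm => h m (by omega)
    rw [Finset.sum_range_succ (fun k => d k * x k)]
    -- Once a weight vanishes all later ones do, so partial sums beyond that point need no sign.
    rcases (hd n).eq_or_lt with h0 | h0
    · have h1 : d (n + 1) = 0 := le_antisymm (h0 ▸ hanti n.le_succ) (hd _)
      rw [h1, ← h0, zero_mul, zero_mul, add_zero]
      simpa [← h0] using ih'
    · have h1 := h n n.lt_succ_self h0
      have h2 := mul_le_mul_of_nonneg_right (hanti n.le_succ) h1
      rw [Finset.sum_range_succ x] at h2 h1 ⊢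
      linarith [mul_add (d n) (∑ k ∈ Finset.range n, x k) (x n)]

lemma sum_mul_nonneg_of_partial_sums {L : ℕ} (d x : Fin L → ℝ) (hd : ∀ k, 0 ≤ d k)
    (hanti : Antitone d) (h : ∀ m, 0 < d m → 0 ≤ ∑ k ∈ Finset.Iic m, x k) :
    0 ≤ ∑ k, d k * x k := by
  set d' : ℕ → ℝ := fun k => if hk : k < L then d ⟨k, hk⟩ else 0 with hd'
  set x' : ℕ → ℝ := fun k => if hk : k < L then x ⟨k, hk⟩ else 0 with hx'
  have hdn : ∀ k, 0 ≤ d' k := by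
    intro k
    by_cases hk : k < L <;> simp [hd', hk, hd]
  have key := mul_sum_range_le_sum_range_mul d' x' hdn (by
    intro a b hab
    by_cases hb : b < L
    · have ha : a < L := by omega
      simp only [hd', ha, hb, dif_pos]
      exact hanti hab
    · simp only [hd', hb, dif_neg, not_false_eq_true]
      exact hdn a) L (by
    intro m hm hpos
    simp only [hd', hm, dif_pos] at hpos
    refine (h ⟨m, hm⟩ hpos).trans_eq ?_
    refine Finset.sum_bij (fun k _ => (k : ℕ)) ?_ ?_ ?_ ?_
    · intro a ha
      simp only [Finset.mem_Iic, Fin.le_def] at ha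
      simp only [Finset.mem_range]
      omega
    · intro a _ b _ hab
      exact Fin.ext hab
    · intro b hb
      simp only [Finset.mem_range] at hb
      exact ⟨⟨b, by omega⟩, by simp only [Finset.mem_Iic, Fin.le_def]; omega, rfl⟩
    · intro a _
      simp [hx'])
  -- Padding by zero makes the boundary term `d' L * ∑ x'` of the Abel summation disappear.
  have h1 : d' L = 0 := by simp [hd']
  rw [h1, zero_mul, ← Fin.sum_univ_eq_sum_range (fun k => d' k * x' k)] at key
  simpa [hd', hx'] using key

variable {m L : ℕ}

lemma sum_sq_mulVec_transpose (U : Matrix (Fin m) (Fin L) ℝ) (x : Fin m → ℝ) :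
    x ⬝ᵥ ((U * Uᵀ) *ᵥ x) = ∑ i, (U.col i ⬝ᵥ x) ^ 2 := by
  rw [← mulVec_mulVec, dotProduct_mulVec, ← mulVec_transpose]
  simp only [dotProduct, mulVec, transpose_apply, col_apply, sq]

lemma sum_mul_sq_mulVec_transpose (U : Matrix (Fin m) (Fin L) ℝ) (ev : Fin L → ℝ)
    (x : Fin m → ℝ) :
    x ⬝ᵥ ((U * diagonal ev * Uᵀ) *ᵥ x) = ∑ i, ev i * (U.col i ⬝ᵥ x) ^ 2 := by
  rw [← mulVec_mulVec, ← mulVec_mulVec, dotProduct_mulVec, ← mulVec_transpose]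
  simp only [dotProduct, mulVec_diagonal]
  refine Finset.sum_congr rfl fun i _ => ?_
  simp only [mulVec, dotProduct, transpose_apply, col_apply]
  ring

lemma mul_eq_mul_diagonal {G : Matrix (Fin m) (Fin m) ℝ} {U : Matrix (Fin m) (Fin L) ℝ}
    {ev : Fin L → ℝ} (h : ∀ k, G *ᵥ U.col k = ev k • U.col k) : G * U = U * diagonal ev := by
  ext i k
  have := congrFun (h k) i
  simp only [Pi.smul_apply, smul_eq_mul, col_apply] at this
  rw [mul_diagonal, mul_comm, ← this]
  rfl

/-- The part of `G` orthogonal to the given eigenvectors. -/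
def deflate (G : Matrix (Fin m) (Fin m) ℝ) (U : Matrix (Fin m) (Fin L) ℝ) (ev : Fin L → ℝ) :
    Matrix (Fin m) (Fin m) ℝ :=
  G - U * diagonal ev * Uᵀ

section Deflate

variable {G : Matrix (Fin m) (Fin m) ℝ} {U : Matrix (Fin m) (Fin L) ℝ} {ev : Fin L → ℝ}

lemma transpose_mul_of_eigenvectors (hG : Gᵀ = G) (hev : ∀ k, G *ᵥ U.col k = ev k • U.col k) :
    Uᵀ * G = diagonal ev * Uᵀ := by
  have := congrArg transpose (mul_eq_mul_diagonal hev)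
  simpa [transpose_mul, hG] using this

lemma transpose_mul_deflate (hG : Gᵀ = G) (hU : Uᵀ * U = 1)
    (hev : ∀ k, G *ᵥ U.col k = ev k • U.col k) : Uᵀ * deflate G U ev = 0 := by
  rw [deflate, Matrix.mul_sub, transpose_mul_of_eigenvectors hG hev, ← Matrix.mul_assoc,
    ← Matrix.mul_assoc, hU,
    Matrix.one_mul, sub_self]

lemma deflate_mul (hU : Uᵀ * U = 1)
    (hev : ∀ k, G *ᵥ U.col k = ev k • U.col k) : deflate G U ev * U = 0 := by
  rw [deflate, Matrix.sub_mul, mul_eq_mul_diagonal hev, Matrix.mul_assoc _ Uᵀ, hU,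
    Matrix.mul_one, sub_self]

lemma transpose_deflate (hG : Gᵀ = G) : (deflate G U ev)ᵀ = deflate G U ev := by
  simp [deflate, transpose_mul, hG, Matrix.mul_assoc]

/-- Since `Uᵀ` annihilates the deflated matrix, its eigenvectors with positive eigenvalue are
orthogonal to `U`, hence eigenvectors of `G` itself, and maximality applies to them. -/
lemma eigenvalue_deflate_le (hG : Gᵀ = G) (hU : Uᵀ * U = 1)
    (hev : ∀ k, G *ᵥ U.col k = ev k • U.col k)
    (htop : ∀ (v : Fin m → ℝ) (a : ℝ), v ≠ 0 → G *ᵥ v = a • v → Uᵀ *ᵥ v = 0 → ∀ k, a ≤ ev k)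
    {v : Fin m → ℝ} {a : ℝ} (hv : v ≠ 0) (h : deflate G U ev *ᵥ v = a • v) (k : Fin L)
    (hk : 0 ≤ ev k) : a ≤ ev k := by
  by_cases ha : a ≤ 0
  · exact ha.trans hk
  have h0 : Uᵀ *ᵥ v = 0 := by
    have h1 : Uᵀ *ᵥ (deflate G U ev *ᵥ v) = 0 := by
      rw [mulVec_mulVec, transpose_mul_deflate hG hU hev, zero_mulVec]
    rw [h, mulVec_smul] at h1
    exact (smul_eq_zero.mp h1).resolve_left (by linarith [lt_of_not_ge ha])
  refine htop v a hv ?_ h0 k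
  rw [← h, deflate, sub_mulVec, ← mulVec_mulVec, h0, mulVec_zero, sub_zero]

lemma posSemidef_of_eigenvalue_nonneg {A : Matrix (Fin m) (Fin m) ℝ} (hA : Aᵀ = A)
    (h : ∀ (v : Fin m → ℝ) (a : ℝ), v ≠ 0 → A *ᵥ v = a • v → 0 ≤ a) : A.PosSemidef := by
  have hh : A.IsHermitian := by rw [IsHermitian, conjTranspose_eq_transpose_of_trivial, hA]
  rw [hh.posSemidef_iff_eigenvalues_nonneg]
  intro i
  refine h (hh.eigenvectorBasis i) _ ?_ (hh.mulVec_eigenvectorBasis i)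
  intro h0
  exact hh.eigenvectorBasis.toBasis.ne_zero i (by ext j; simpa using congrFun h0 j)

/-- A symmetric positive semidefinite matrix is bounded by its top eigenvectors. -/
lemma dotProduct_mulVec_le (hG : Gᵀ = G) (hU : Uᵀ * U = 1)
    (hev : ∀ k, G *ᵥ U.col k = ev k • U.col k)
    (htop : ∀ (v : Fin m → ℝ) (a : ℝ), v ≠ 0 → G *ᵥ v = a • v → Uᵀ *ᵥ v = 0 → ∀ k, a ≤ ev k)
    (k : Fin L) (hk : 0 ≤ ev k) (x : Fin m → ℝ) :
    x ⬝ᵥ (G *ᵥ x) ≤ ev k * (x ⬝ᵥ x) + ∑ i, (ev i - ev k) * (U.col i ⬝ᵥ x) ^ 2 := by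
  have h1 : (ev k • (1 : Matrix (Fin m) (Fin m) ℝ) - deflate G U ev).PosSemidef := by
    refine posSemidef_of_eigenvalue_nonneg (by simp [transpose_deflate hG]) ?_
    intro v a hv h
    rw [sub_mulVec, smul_mulVec, one_mulVec] at h
    have := eigenvalue_deflate_le hG hU hev htop hv (a := ev k - a)
      (by rw [sub_smul, ← h]; abel) k hk
    linarith
  -- Compressing by the projection off the columns of `U` fixes the deflated matrix and turns `ev k
  -- • 1` into `ev k • (1 - U * Uᵀ)`, whence the coefficients `ev i - ev k`.
  have h2 := h1.conjTranspose_mul_mul_same (1 - U * Uᵀ)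
  have h3 : (1 - U * Uᵀ)ᴴ * (ev k • (1 : Matrix (Fin m) (Fin m) ℝ) - deflate G U ev) *
      (1 - U * Uᵀ) = ev k • 1 - ev k • (U * Uᵀ) - (G - U * diagonal ev * Uᵀ) := by
    have e1 : (U * Uᵀ) * (U * Uᵀ) = U * Uᵀ := by
      rw [Matrix.mul_assoc, ← Matrix.mul_assoc Uᵀ, hU, Matrix.one_mul]
    have e2 : (U * Uᵀ) * deflate G U ev = 0 := by
      rw [Matrix.mul_assoc, transpose_mul_deflate hG hU hev, Matrix.mul_zero]
    have e3 : deflate G U ev * (U * Uᵀ) = 0 := by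
      rw [← Matrix.mul_assoc, deflate_mul hU hev, Matrix.zero_mul]
    have e4 : (1 - U * Uᵀ)ᴴ = 1 - U * Uᵀ := by
      rw [conjTranspose_eq_transpose_of_trivial]; simp
    rw [e4, Matrix.sub_mul, Matrix.one_mul, Matrix.mul_sub (U * Uᵀ), e2, sub_zero,
      mul_smul_comm, Matrix.mul_one, Matrix.mul_sub,
      Matrix.mul_one, Matrix.sub_mul, Matrix.sub_mul, smul_mul_assoc,
      Matrix.one_mul, e3, smul_mul_assoc, e1, deflate]
    abel
  rw [h3] at h2
  have h4 := h2.dotProduct_mulVec_nonneg x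
  simp only [star_trivial] at h4
  rw [sub_mulVec, sub_mulVec, sub_mulVec, smul_mulVec, smul_mulVec, one_mulVec, dotProduct_sub,
    dotProduct_sub, dotProduct_sub, dotProduct_smul, dotProduct_smul, sum_sq_mulVec_transpose,
    sum_mul_sq_mulVec_transpose, smul_eq_mul, smul_eq_mul] at h4
  simp only [sub_mul, Finset.sum_sub_distrib, ← Finset.mul_sum]
  linarith

/-- If `ev k = 0`, maximality leaves the deflated matrix no positive eigenvalue; being a compression
of `G` it has no negative one either. So `G = U diag(ev) Uᵀ`, whose rank is below `L`. -/
lemma eigenvalue_pos (hG : G.PosSemidef) (hrank : L ≤ G.rank) (hU : Uᵀ * U = 1)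
    (hev : ∀ k, G *ᵥ U.col k = ev k • U.col k)
    (htop : ∀ (v : Fin m → ℝ) (a : ℝ), v ≠ 0 → G *ᵥ v = a • v → Uᵀ *ᵥ v = 0 → ∀ k, a ≤ ev k)
    (k : Fin L) : 0 < ev k := by
  have hGt : Gᵀ = G := by
    rw [← conjTranspose_eq_transpose_of_trivial]; exact hG.isHermitian
  have hcol : U.col k ⬝ᵥ U.col k = 1 := by
    have := congrFun (congrFun hU k) k
    simpa [mul_apply, dotProduct] using this
  have hnn : 0 ≤ ev k := by
    have := hG.dotProduct_mulVec_nonneg (U.col k)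
    rw [hev k, dotProduct_smul, star_trivial, hcol] at this
    simpa using this
  refine hnn.lt_of_ne fun h0 => ?_
  have hdef : deflate G U ev = 0 := by
    have hsymm : (deflate G U ev).IsHermitian := by
      rw [IsHermitian, conjTranspose_eq_transpose_of_trivial, transpose_deflate hGt]
    have hne : ∀ i, (hsymm.eigenvectorBasis i : Fin m → ℝ) ≠ 0 := fun i h0 =>
      hsymm.eigenvectorBasis.toBasis.ne_zero i (by ext j; simpa using congrFun h0 j)
    rw [← hsymm.eigenvalues_eq_zero_iff]
    funext i
    refine le_antisymm ?_ ?_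
    · have := eigenvalue_deflate_le hGt hU hev htop (hne i) (hsymm.mulVec_eigenvectorBasis i) k hnn
      rw [← h0] at this
      exact this
    · have h1 : ((1 - U * Uᵀ)ᴴ * G * (1 - U * Uᵀ)).PosSemidef := hG.conjTranspose_mul_mul_same _
      have h2 : (1 - U * Uᵀ)ᴴ * G * (1 - U * Uᵀ) = deflate G U ev := by
        rw [conjTranspose_eq_transpose_of_trivial, transpose_sub, transpose_one, transpose_mul,
          transpose_transpose, Matrix.sub_mul, Matrix.one_mul, Matrix.mul_assoc,
          transpose_mul_of_eigenvectors hGt hev,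
          ← Matrix.mul_assoc, ← deflate, Matrix.mul_sub, Matrix.mul_one, ← Matrix.mul_assoc,
          deflate_mul hU hev, Matrix.zero_mul,
          sub_zero]
      rw [h2] at h1
      exact h1.eigenvalues_nonneg i
  have hGe : G = U * diagonal ev * Uᵀ := sub_eq_zero.mp hdef
  have hr1 : G.rank ≤ (diagonal ev).rank := by
    rw [hGe]
    exact (rank_mul_le_left _ _).trans (rank_mul_le_right _ _)
  rw [rank_diagonal] at hr1
  have : Fintype.card {i // ev i ≠ 0} < Fintype.card (Fin L) :=
    Fintype.card_subtype_lt (x := k) (by simp [← h0])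
  rw [Fintype.card_fin] at this
  omega

end Deflate

/-- Bessel's inequality for the semi-inner product given by `G`. -/
lemma bessel_mulVec {ι : Type*} [DecidableEq ι] {G : Matrix (Fin m) (Fin m) ℝ}
    (hG : G.PosSemidef) (S : Finset ι) (c : ι → Fin m → ℝ)
    (hc : ∀ k ∈ S, ∀ l ∈ S, c k ⬝ᵥ (G *ᵥ c l) = if k = l then 1 else 0) (u : Fin m → ℝ) :
    ∑ k ∈ S, (u ⬝ᵥ (G *ᵥ c k)) ^ 2 ≤ u ⬝ᵥ (G *ᵥ u) := by
  have hGt : Gᵀ = G := by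
    rw [← conjTranspose_eq_transpose_of_trivial]; exact hG.isHermitian
  have hsymm : ∀ x y : Fin m → ℝ, x ⬝ᵥ (G *ᵥ y) = y ⬝ᵥ (G *ᵥ x) := by
    intro x y
    rw [dotProduct_mulVec, ← mulVec_transpose, hGt, dotProduct_comm]
  set a : ι → ℝ := fun k => u ⬝ᵥ (G *ᵥ c k) with ha
  set p : Fin m → ℝ := ∑ k ∈ S, a k • c k with hp
  have h1 : u ⬝ᵥ (G *ᵥ p) = ∑ k ∈ S, a k ^ 2 := by
    simp only [hp, mulVec_sum, mulVec_smul, dotProduct_sum, dotProduct_smul, smul_eq_mul, sq]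
    rfl
  have h2 : p ⬝ᵥ (G *ᵥ p) = ∑ k ∈ S, a k ^ 2 := by
    rw [hp, mulVec_sum, dotProduct_sum]
    refine Finset.sum_congr rfl fun k hk => ?_
    rw [mulVec_smul, dotProduct_smul, sum_dotProduct, smul_eq_mul, sq]
    congr 1
    rw [Finset.sum_congr rfl fun l hl => by rw [smul_dotProduct, hc l hl k hk]]
    simp [hk]
  have h3 := hG.dotProduct_mulVec_nonneg (u - p)
  rw [star_trivial, mulVec_sub, dotProduct_sub, sub_dotProduct, sub_dotProduct, hsymm p u, h1,
    h2] at h3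
  simp only [ha] at h3
  linarith

/-- A Ky Fan type bound: `G`-orthonormal vectors are long. -/
lemma sum_inv_le_sum_dotProduct {ι κ : Type*} [DecidableEq ι] {G : Matrix (Fin m) (Fin m) ℝ}
    (hG : G.PosSemidef) (S : Finset ι) (T : Finset κ) (hcard : S.card = T.card)
    (c : ι → Fin m → ℝ)
    (hc : ∀ k ∈ S, ∀ l ∈ S, c k ⬝ᵥ (G *ᵥ c l) = if k = l then 1 else 0)
    (u : κ → Fin m → ℝ) (lam : κ → ℝ) (hu : ∀ i ∈ T, u i ⬝ᵥ u i = 1)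
    (hGu : ∀ i ∈ T, G *ᵥ u i = lam i • u i) (t : ℝ) (ht : 0 < t) (hlam : ∀ i ∈ T, t ≤ lam i)
    (hq : ∀ x : Fin m → ℝ,
      x ⬝ᵥ (G *ᵥ x) ≤ t * (x ⬝ᵥ x) + ∑ i ∈ T, (lam i - t) * (u i ⬝ᵥ x) ^ 2) :
    ∑ i ∈ T, (lam i)⁻¹ ≤ ∑ k ∈ S, c k ⬝ᵥ c k := by
  have hGt : Gᵀ = G := by
    rw [← conjTranspose_eq_transpose_of_trivial]; exact hG.isHermitian
  have h1 : ∑ k ∈ S, c k ⬝ᵥ (G *ᵥ c k) = T.card := by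
    rw [Finset.sum_congr rfl fun k hk => hc k hk k hk]
    simp [hcard]
  have h2 := Finset.sum_le_sum fun k (_ : k ∈ S) => hq (c k)
  rw [h1, Finset.sum_add_distrib, ← Finset.mul_sum, Finset.sum_comm] at h2
  -- Bessel for `u i` reads `lam i ^ 2 * ∑ (u i ⬝ᵥ c k) ^ 2 ≤ lam i`. Summing `hq` over the `c k`,
  -- the two counts `T.card` then cancel and a factor `t` remains.
  have h3 : ∀ i ∈ T, ∑ k ∈ S, (lam i - t) * (u i ⬝ᵥ c k) ^ 2 ≤ 1 - t * (lam i)⁻¹ := by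
    intro i hi
    have hpos : 0 < lam i := ht.trans_le (hlam i hi)
    have hb := bessel_mulVec hG S c hc (u i)
    have e : ∀ k, u i ⬝ᵥ (G *ᵥ c k) = lam i * (u i ⬝ᵥ c k) := by
      intro k
      rw [dotProduct_mulVec, ← mulVec_transpose, hGt, hGu i hi, smul_dotProduct, smul_eq_mul]
    simp only [e, mul_pow, ← Finset.mul_sum] at hb
    rw [hGu i hi, dotProduct_smul, hu i hi, smul_eq_mul, mul_one] at hb
    have hb' : ∑ k ∈ S, (u i ⬝ᵥ c k) ^ 2 ≤ (lam i)⁻¹ := by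
      rw [← one_div, le_div_iff₀ hpos]
      nlinarith
    rw [← Finset.mul_sum]
    calc _ ≤ (lam i - t) * (lam i)⁻¹ :=
          mul_le_mul_of_nonneg_left hb' (sub_nonneg.mpr (hlam i hi))
      _ = _ := by rw [sub_mul, mul_inv_cancel₀ hpos.ne']
  have h4 := Finset.sum_le_sum h3
  rw [Finset.sum_sub_distrib, ← Finset.mul_sum] at h4
  simp only [Finset.sum_const, nsmul_eq_mul, mul_one] at h4
  refine le_of_mul_le_mul_left ?_ ht
  linarith

/-- If `Cᵀ G C` is diagonal, its diagonal entries, divided by the top eigenvalues of `G` in the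
same order, bound the energy of `C` from below. -/
lemma sum_div_le_trace {G : Matrix (Fin m) (Fin m) ℝ} {U : Matrix (Fin m) (Fin L) ℝ}
    {ev : Fin L → ℝ} (hG : G.PosSemidef) (hU : Uᵀ * U = 1)
    (hev : ∀ k, G *ᵥ U.col k = ev k • U.col k)
    (htop : ∀ (v : Fin m → ℝ) (a : ℝ), v ≠ 0 → G *ᵥ v = a • v → Uᵀ *ᵥ v = 0 → ∀ k, a ≤ ev k)
    (hpos : ∀ k, 0 < ev k) (C : Matrix (Fin m) (Fin L) ℝ) (d : Fin L → ℝ)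
    (hC : Cᵀ * G * C = diagonal d) (hd : ∀ k, 0 ≤ d k) (π : Equiv.Perm (Fin L))
    (hevπ : Antitone (ev ∘ π)) (hdπ : Antitone (d ∘ π)) :
    ∑ k, d k / ev k ≤ (Cᵀ * C).trace := by
  have hGt : Gᵀ = G := by
    rw [← conjTranspose_eq_transpose_of_trivial]; exact hG.isHermitian
  have hentry : ∀ k l, C.col k ⬝ᵥ (G *ᵥ C.col l) = if k = l then d k else 0 := by
    intro k l
    have := congrFun (congrFun hC k) l
    refine Eq.trans ?_ (this.trans (diagonal_apply d k l))
    rw [Matrix.mul_assoc]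
    simp [mul_apply, dotProduct, mulVec]
  have htr : (Cᵀ * C).trace = ∑ k, C.col k ⬝ᵥ C.col k := by
    simp [trace, mul_apply, dotProduct]
  have hcol : ∀ k, U.col k ⬝ᵥ U.col k = 1 := by
    intro k
    have := congrFun (congrFun hU k) k
    simpa [mul_apply, dotProduct] using this
  -- Squared length of the `G`-normalised column. Where `d k = 0` the quotient is `0`, harmless
  -- since `a k` is always weighted by `d k`.
  set a : Fin L → ℝ := fun k => (C.col k ⬝ᵥ C.col k) / d k with ha
  have hcc : ∀ k, 0 ≤ C.col k ⬝ᵥ C.col k := fun k =>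
    Finset.sum_nonneg fun i _ => mul_self_nonneg _
  have h1 : ∀ k, d k * a k ≤ C.col k ⬝ᵥ C.col k := by
    intro k
    rcases (hd k).eq_or_lt with h | h
    · rw [← h, zero_mul]; exact hcc k
    · rw [ha]; exact (mul_div_cancel₀ _ h.ne').le
  rw [htr]
  refine le_trans ?_ (Finset.sum_le_sum fun k _ => h1 k)
  have key : 0 ≤ ∑ k, d (π k) * (a (π k) - (ev (π k))⁻¹) := by
    refine sum_mul_nonneg_of_partial_sums (d ∘ π) _ (fun k => hd _) hdπ ?_
    intro q hq
    rw [Finset.sum_sub_distrib, sub_nonneg]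
    have hdpos : ∀ k ∈ Finset.Iic q, 0 < d (π k) := fun k hk =>
      hq.trans_le (hdπ (Finset.mem_Iic.mp hk))
    have hb := sum_inv_le_sum_dotProduct hG (Finset.Iic q) (Finset.Iic q) rfl
      (fun k => (√(d (π k)))⁻¹ • C.col (π k)) ?_ (fun i => U.col (π i)) (fun i => ev (π i))
      (fun i _ => hcol _) (fun i _ => hev _) (ev (π q)) (hpos _)
      (fun i hi => hevπ (Finset.mem_Iic.mp hi)) ?_
    · refine hb.trans_eq (Finset.sum_congr rfl fun k hk => ?_)
      rw [smul_dotProduct, dotProduct_smul, smul_eq_mul, smul_eq_mul, ← mul_assoc, ← mul_inv,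
        Real.mul_self_sqrt (hd _)]
      exact (div_eq_inv_mul _ _).symm
    · intro k hk l hl
      rw [mulVec_smul, smul_dotProduct, dotProduct_smul, hentry]
      simp only [EmbeddingLike.apply_eq_iff_eq, smul_eq_mul]
      split_ifs with hkl
      · subst hkl
        rw [← mul_assoc, ← mul_inv, Real.mul_self_sqrt (hd _),
          inv_mul_cancel₀ (hdpos k hk).ne']
      · simp
    · intro x
      refine (dotProduct_mulVec_le hGt hU hev htop (π q) (hpos _).le x).trans ?_
      refine add_le_add le_rfl ?_
      rw [← Equiv.sum_comp π]
      -- Eigenvalues ranked after `q` are at most `ev (π q)`, so their terms are nonpositive and can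
      -- be dropped.
      refine (Finset.sum_le_sum (g := fun i => if i ∈ Finset.Iic q then
        (ev (π i) - ev (π q)) * (U.col (π i) ⬝ᵥ x) ^ 2 else 0) fun i _ => ?_).trans_eq ?_
      · split_ifs with hi
        · exact le_rfl
        · have hqi : q ≤ i := by
            rw [Finset.mem_Iic, not_le] at hi
            exact hi.le
          exact mul_nonpos_of_nonpos_of_nonneg (sub_nonpos.mpr (hevπ hqi)) (sq_nonneg _)
      · rw [Finset.sum_ite_mem, Finset.univ_inter]
  rw [Equiv.sum_comp π fun k => d k * (a k - (ev k)⁻¹)] at key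
  simp only [mul_sub, Finset.sum_sub_distrib, sub_nonneg] at key
  simpa [div_eq_mul_inv] using key

end TopEigenvectors

/-! ### Energy-minimal precoders with a prescribed Gram matrix -/

section Precoders

variable {m L : ℕ}

lemma exists_perm_antitone (f : Fin L → ℝ) : ∃ π : Equiv.Perm (Fin L), Antitone (f ∘ π) := by
  refine ⟨Tuple.sort (fun i => -f i), fun a b hab => ?_⟩
  have := Tuple.monotone_sort (fun i => -f i) hab
  simpa using this

/-- Every precoder can be replaced by one with left singular vectors `U` and no larger energy,
without changing the Gram matrix of the received signal. -/
lemma exists_hasLeftSingularVectors {G : Matrix (Fin m) (Fin m) ℝ} (hG : G.PosSemidef)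
    (hrank : L ≤ G.rank) {U : Matrix (Fin m) (Fin L) ℝ} (hU : IsTopEigenvectors G U)
    (B : Matrix (Fin m) (Fin L) ℝ) :
    ∃ B' : Matrix (Fin m) (Fin L) ℝ, HasLeftSingularVectors B' U ∧
      B'ᵀ * G * B' = Bᵀ * G * B ∧ (B' * B'ᵀ).trace ≤ (B * Bᵀ).trace := by
  obtain ⟨hUU, ev, hev, htop'⟩ := hU
  have htop := fun (v : Fin m → ℝ) (a : ℝ) hv h1 h2 k => htop' v a hv h1 h2 k
  have hpos := eigenvalue_pos hG hrank hUU hev htop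
  have hM : (Bᵀ * G * B).PosSemidef := by
    have := hG.conjTranspose_mul_mul_same B
    rwa [conjTranspose_eq_transpose_of_trivial] at this
  have hMh := hM.isHermitian
  obtain ⟨V, hV1, hV2, d, hd, hMd⟩ : ∃ V : Matrix (Fin L) (Fin L) ℝ, Vᵀ * V = 1 ∧ V * Vᵀ = 1 ∧
      ∃ d : Fin L → ℝ, (∀ k, 0 ≤ d k) ∧ Bᵀ * G * B = V * diagonal d * Vᵀ := by
    have h1 : (hMh.eigenvectorUnitary : Matrix (Fin L) (Fin L) ℝ)ᵀ * hMh.eigenvectorUnitary = 1 := by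
      have := Unitary.coe_star_mul_self hMh.eigenvectorUnitary
      rwa [star_eq_conjTranspose, conjTranspose_eq_transpose_of_trivial] at this
    refine ⟨hMh.eigenvectorUnitary, h1, mul_eq_one_comm.mp h1, hMh.eigenvalues,
      hM.eigenvalues_nonneg, ?_⟩
    · have := hMh.spectral_theorem
      rw [Unitary.conjStarAlgAut_apply, star_eq_conjTranspose,
        conjTranspose_eq_transpose_of_trivial] at this
      exact this
  obtain ⟨π, hπ⟩ := exists_perm_antitone ev
  obtain ⟨ρ, hρ⟩ := exists_perm_antitone d
  -- Chosen so that `d ∘ τ ∘ π = d ∘ ρ`: one permutation `π` then sorts both `ev` and the reordered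
  -- `d`.
  set τ : Equiv.Perm (Fin L) := π⁻¹.trans ρ with hτ
  set V' : Matrix (Fin L) (Fin L) ℝ := V.submatrix id τ with hV'
  set d' : Fin L → ℝ := d ∘ τ with hd'
  have hV'1 : V'ᵀ * V' = 1 := by
    rw [hV', transpose_submatrix, ← submatrix_mul _ _ _ _ _ Function.bijective_id, hV1]
    exact submatrix_one_equiv τ
  have hV'2 : V' * V'ᵀ = 1 := mul_eq_one_comm.mp hV'1
  have hMd' : Bᵀ * G * B = V' * diagonal d' * V'ᵀ := by
    rw [hMd, hV', transpose_submatrix, hd',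
      show diagonal (d ∘ τ) = (diagonal d).submatrix τ τ from (submatrix_diagonal_equiv d τ).symm,
      submatrix_mul_equiv, submatrix_mul_equiv]
    rfl
  have hd'nn : ∀ k, 0 ≤ d' k := fun k => hd _
  have hd'π : Antitone (d' ∘ π) := by
    have : d' ∘ π = d ∘ ρ := by
      funext k
      simp [hd', hτ]
    rw [this]; exact hρ
  have hCd : (B * V')ᵀ * G * (B * V') = diagonal d' := by
    calc (B * V')ᵀ * G * (B * V') = V'ᵀ * (Bᵀ * G * B) * V' := by
          simp only [transpose_mul, Matrix.mul_assoc]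
      _ = (V'ᵀ * V') * diagonal d' * (V'ᵀ * V') := by
          rw [hMd']; simp only [Matrix.mul_assoc]
      _ = diagonal d' := by rw [hV'1, Matrix.one_mul, Matrix.mul_one]
  have hbound := sum_div_le_trace hG hUU hev htop hpos (B * V') d' hCd hd'nn π hπ hd'π
  have htrB : ((B * V')ᵀ * (B * V')).trace = (B * Bᵀ).trace := by
    rw [trace_mul_comm, transpose_mul, Matrix.mul_assoc, ← Matrix.mul_assoc V', hV'2,
      Matrix.one_mul]
  -- Forced by `σ k ^ 2 * ev k = d' k`, the condition that the Gram matrix is unchanged.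
  set σ : Fin L → ℝ := fun k => √(d' k / ev k) with hσ
  have hσσ : ∀ k, σ k * σ k = d' k / ev k := fun k =>
    Real.mul_self_sqrt (div_nonneg (hd'nn k) (hpos k).le)
  refine ⟨U * diagonal σ * V'ᵀ, ⟨hUU, σ, V', fun k => Real.sqrt_nonneg _, ?_, rfl⟩, ?_, ?_⟩
  · rw [mem_orthogonalGroup_iff]
    exact hV'2
  · rw [hMd']
    calc (U * diagonal σ * V'ᵀ)ᵀ * G * (U * diagonal σ * V'ᵀ)
        = V' * (diagonal σ * (Uᵀ * (G * U)) * diagonal σ) * V'ᵀ := by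
          simp only [transpose_mul, transpose_transpose, diagonal_transpose, Matrix.mul_assoc]
      _ = V' * diagonal d' * V'ᵀ := by
          rw [mul_eq_mul_diagonal hev, ← Matrix.mul_assoc Uᵀ, hUU, Matrix.one_mul,
            diagonal_mul_diagonal, diagonal_mul_diagonal]
          congr 3
          funext k
          rw [mul_right_comm, hσσ, div_mul_cancel₀ _ (hpos k).ne']
  · rw [← htrB]
    refine le_trans (le_of_eq ?_) hbound
    calc (U * diagonal σ * V'ᵀ * (U * diagonal σ * V'ᵀ)ᵀ).trace
        = (U * (diagonal σ * (V'ᵀ * V') * diagonal σ * Uᵀ)).trace := by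
          simp only [transpose_mul, transpose_transpose, diagonal_transpose, Matrix.mul_assoc]
      _ = (diagonal σ * diagonal σ * (Uᵀ * U)).trace := by
          rw [trace_mul_comm, hV'1, Matrix.mul_one, Matrix.mul_assoc]
      _ = ∑ k, d' k / ev k := by
          rw [hUU, Matrix.mul_one, diagonal_mul_diagonal, trace_diagonal]
          simp only [hσσ]

lemma exists_matrix_of_linearIsometry {n : ℕ}
    (q : EuclideanSpace ℝ (Fin n) →ₗᵢ[ℝ] EuclideanSpace ℝ (Fin n)) :
    ∃ Q : Matrix (Fin n) (Fin n) ℝ, Qᵀ * Q = 1 ∧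
      ∀ v : Fin n → ℝ, Q *ᵥ v = (q (WithLp.toLp 2 v)).ofLp := by
  obtain ⟨Q, hQ⟩ := (toEuclideanLin (𝕜 := ℝ) (m := Fin n) (n := Fin n)).surjective q.toLinearMap
  have hQq : ∀ v : Fin n → ℝ, Q *ᵥ v = (q (WithLp.toLp 2 v)).ofLp := by
    intro v
    have h2 := congrArg WithLp.ofLp (LinearMap.congr_fun hQ (WithLp.toLp 2 v))
    simpa using h2
  refine ⟨Q, ?_, hQq⟩
  ext i j
  have h1 := q.inner_map_map (WithLp.toLp 2 (Pi.single i 1)) (WithLp.toLp 2 (Pi.single j 1))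
  rw [EuclideanSpace.inner_eq_star_dotProduct, EuclideanSpace.inner_eq_star_dotProduct, ← hQq,
    ← hQq, mulVec_single_one, mulVec_single_one, star_trivial, star_trivial,
    dotProduct_single_one, dotProduct_comm] at h1
  refine Eq.trans ?_ (h1.trans ?_)
  · simp [Matrix.mul_apply, dotProduct]
  · simp [Pi.single_apply, one_apply]

/-- Matrices with the same Gram matrix differ by an orthogonal matrix on the left. -/
lemma exists_orthogonal_mul_eq {n L : ℕ} (A A' : Matrix (Fin n) (Fin L) ℝ)
    (h : Aᵀ * A = A'ᵀ * A') :
    ∃ Q : Matrix (Fin n) (Fin n) ℝ, Qᵀ * Q = 1 ∧ A' = Q * A := by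
  set f := toEuclideanLin A with hf
  set f' := toEuclideanLin A' with hf'
  have key : ∀ (C : Matrix (Fin n) (Fin L) ℝ) (x : EuclideanSpace ℝ (Fin L)),
      ‖toEuclideanLin C x‖ ^ 2 = x.ofLp ⬝ᵥ ((Cᵀ * C) *ᵥ x.ofLp) := by
    intro C x
    rw [EuclideanSpace.norm_sq_eq, ← mulVec_mulVec, dotProduct_mulVec, ← mulVec_transpose,
      transpose_transpose]
    simp [dotProduct, sq]
  have hnorm : ∀ x, ‖f x‖ = ‖f' x‖ := by
    intro x
    rw [← sq_eq_sq₀ (norm_nonneg _) (norm_nonneg _), hf, hf', key, key, h]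
  have hker : LinearMap.ker f ≤ LinearMap.ker f' := by
    intro x hx
    rw [LinearMap.mem_ker] at hx ⊢
    rw [← norm_eq_zero, ← hnorm, hx, norm_zero]
  -- Equal Gram matrices give `‖f x‖ = ‖f' x‖`, so `f x ↦ f' x` is a well-defined isometry on the
  -- range of `f`; it extends to the whole space.
  set g : LinearMap.range f →ₗ[ℝ] EuclideanSpace ℝ (Fin n) :=
    ((LinearMap.ker f).liftQ f' hker).comp f.quotKerEquivRange.symm.toLinearMap with hg
  have hgf : ∀ x, g ⟨f x, LinearMap.mem_range_self f x⟩ = f' x := by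
    intro x
    have : f.quotKerEquivRange.symm ⟨f x, LinearMap.mem_range_self f x⟩ =
        (LinearMap.ker f).mkQ x := by
      rw [LinearEquiv.symm_apply_eq]
      ext1
      simp
    simp [hg, this]
  let gi : LinearMap.range f →ₗᵢ[ℝ] EuclideanSpace ℝ (Fin n) :=
    ⟨g, by
      rintro ⟨_, x, rfl⟩
      rw [hgf, ← hnorm]
      rfl⟩
  set q := gi.extend with hq
  have hqf : ∀ x, q (f x) = f' x := fun x =>
    (gi.extend_apply ⟨f x, LinearMap.mem_range_self f x⟩).trans (hgf x)
  obtain ⟨Q, hQ1, hQ2⟩ := exists_matrix_of_linearIsometry q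
  refine ⟨Q, hQ1, ?_⟩
  apply toEuclideanLin.injective
  ext1 x
  have h1 := (hqf x).symm
  rw [hf, hf', toLpLin_apply, toLpLin_apply] at h1
  rw [toLpLin_apply, toLpLin_apply, h1, ← mulVec_mulVec, hQ2]

end Precoders

/-! ### Gaussian noise, output density and the information integral -/

section OutputDensity

variable {n L : ℕ}

/-- The standard Gaussian law on `ℝⁿ`. -/
abbrev stdNoise (n : ℕ) : Measure (Fin n → ℝ) := Measure.pi (fun _ : Fin n => gaussianReal 0 1)

/-- The density of the standard Gaussian law. -/
def noiseDensity (w : Fin n → ℝ) : ℝ := ∏ i, gaussianPDFReal 0 1 (w i)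

/-- The logarithm of the largest value of `noiseDensity`. -/
def logPeak (n : ℕ) : ℝ := n * Real.log (√(2 * Real.pi))⁻¹

lemma noiseDensity_eq (w : Fin n → ℝ) :
    noiseDensity w = Real.exp (logPeak n - (w ⬝ᵥ w) / 2) := by
  have hpos : 0 < (√(2 * Real.pi))⁻¹ := by positivity
  have h : ∀ x : ℝ, gaussianPDFReal 0 1 x =
      Real.exp (Real.log (√(2 * Real.pi))⁻¹ - x * x / 2) := by
    intro x
    rw [Real.exp_sub, Real.exp_log hpos, gaussianPDFReal]
    simp only [NNReal.coe_one, mul_one, sub_zero]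
    rw [div_eq_mul_inv _ (Real.exp _), ← Real.exp_neg]
    congr 2
    ring
  simp only [noiseDensity, h]
  rw [← Real.exp_sum, Finset.sum_sub_distrib]
  simp [logPeak, dotProduct, Finset.sum_div]

lemma noiseDensity_pos (w : Fin n → ℝ) : 0 < noiseDensity w := by
  rw [noiseDensity_eq]; exact Real.exp_pos _

lemma log_noiseDensity (w : Fin n → ℝ) :
    Real.log (noiseDensity w) = logPeak n - (w ⬝ᵥ w) / 2 := by
  rw [noiseDensity_eq, Real.log_exp]

lemma logPeak_nonpos (n : ℕ) : logPeak n ≤ 0 := by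
  refine mul_nonpos_of_nonneg_of_nonpos (Nat.cast_nonneg n) ?_
  refine Real.log_nonpos (by positivity) (inv_le_one_of_one_le₀ ?_)
  rw [Real.one_le_sqrt]
  nlinarith [Real.pi_gt_three]

lemma dotProduct_self_nonneg' (w : Fin n → ℝ) : 0 ≤ w ⬝ᵥ w :=
  Finset.sum_nonneg fun _ _ => mul_self_nonneg _

lemma noiseDensity_le_one (w : Fin n → ℝ) : noiseDensity w ≤ 1 := by
  rw [noiseDensity_eq, Real.exp_le_one_iff]
  linarith [logPeak_nonpos n, dotProduct_self_nonneg' w]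

@[fun_prop]
lemma continuous_noiseDensity : Continuous (noiseDensity : (Fin n → ℝ) → ℝ) := by
  have : (noiseDensity : (Fin n → ℝ) → ℝ) =
      fun w => Real.exp (logPeak n - (w ⬝ᵥ w) / 2) := funext noiseDensity_eq
  rw [this]
  fun_prop

lemma noiseDensity_mulVec (Q : Matrix (Fin n) (Fin n) ℝ) (hQ : Qᵀ * Q = 1) (w : Fin n → ℝ) :
    noiseDensity (Q *ᵥ w) = noiseDensity w := by
  rw [noiseDensity_eq, noiseDensity_eq, dotProduct_mulVec, ← mulVec_transpose, mulVec_mulVec,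
    hQ, one_mulVec]

lemma stdNoise_eq_withDensity :
    stdNoise n = volume.withDensity fun w => ENNReal.ofReal (noiseDensity w) := by
  refine Measure.pi_eq fun s hs => ?_
  have hint : ∀ i, Integrable (gaussianPDFReal 0 1) (volume.restrict (s i)) := fun i =>
    (integrable_gaussianPDFReal 0 1).restrict
  rw [withDensity_apply _ (MeasurableSet.univ_pi hs), volume_pi, Measure.restrict_pi_pi]
  rw [← ofReal_integral_eq_lintegral_ofReal]
  · simp only [noiseDensity]
    rw [integral_fintype_prod_eq_prod (fun _ => gaussianPDFReal 0 1),
      ENNReal.ofReal_prod_of_nonneg]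
    · refine Finset.prod_congr rfl fun i _ => ?_
      rw [gaussianReal_apply_eq_integral 0 one_ne_zero]
    · exact fun i _ => integral_nonneg fun x => gaussianPDFReal_nonneg _ _ _
  · exact Integrable.fintype_prod hint
  · exact ae_of_all _ fun w => (noiseDensity_pos w).le

/-- The density depends only on `w ⬝ᵥ w`, and `|det Q| = 1` preserves Lebesgue measure. -/
lemma map_mulVec_stdNoise (Q : Matrix (Fin n) (Fin n) ℝ) (hQ : Qᵀ * Q = 1) :
    (stdNoise n).map (fun w => Q *ᵥ w) = stdNoise n := by
  have hdet : Q.det * Q.det = 1 := by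
    have := congrArg det hQ
    rwa [det_mul, det_transpose, det_one] at this
  have hne : Q.det ≠ 0 := fun h => by simp [h] at hdet
  have habs : |Q.det⁻¹| = 1 := by
    rw [abs_inv]
    rcases mul_self_eq_one_iff.mp hdet with h | h <;> simp [h]
  have hvol : (volume : Measure (Fin n → ℝ)).map (fun w => Q *ᵥ w) = volume := by
    have := Real.map_matrix_volume_pi_eq_smul_volume_pi hne
    rw [habs, ENNReal.ofReal_one, one_smul] at this
    exact this
  have hm : Measurable fun w : Fin n → ℝ => Q *ᵥ w := by
    have : Continuous fun w : Fin n → ℝ => Q *ᵥ w := by fun_prop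
    exact this.measurable
  have hinv := noiseDensity_mulVec Q hQ
  have hgm : Measurable fun w : Fin n → ℝ => ENNReal.ofReal (noiseDensity w) :=
    (continuous_noiseDensity.measurable).ennreal_ofReal
  refine Measure.ext_of_lintegral _ fun φ hφ => ?_
  rw [lintegral_map hφ hm, stdNoise_eq_withDensity,
    lintegral_withDensity_eq_lintegral_mul _ hgm (g := fun w => φ (Q *ᵥ w)) (hφ.comp hm),
    lintegral_withDensity_eq_lintegral_mul _ hgm hφ]
  conv_rhs => rw [← hvol]
  rw [lintegral_map (hgm.mul hφ) hm]
  simp [hinv]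

lemma integrable_dotProduct_self_stdNoise :
    Integrable (fun w : Fin n → ℝ => w ⬝ᵥ w) (stdNoise n) := by
  simp only [dotProduct]
  refine integrable_finsetSum _ fun i _ => ?_
  have h1 : Integrable (fun x : ℝ => x * x) (gaussianReal 0 1) := by
    have := (memLp_id_gaussianReal (μ := 0) (v := 1) 2).integrable_sq
    simpa [sq] using this
  exact (measurePreserving_eval (fun _ : Fin n => gaussianReal 0 1) i
    ).integrable_comp_of_integrable h1

/-- The density of the output `A x + w`, where `x` has law `P`. -/
def outputDensity (P : Measure (Fin L → ℝ)) (A : Matrix (Fin n) (Fin L) ℝ) (y : Fin n → ℝ) : ℝ :=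
  ∫ x, noiseDensity (y - A *ᵥ x) ∂P

section Output

variable (P : Measure (Fin L → ℝ)) [IsProbabilityMeasure P]

lemma integrable_noiseDensity_sub (A : Matrix (Fin n) (Fin L) ℝ) (y : Fin n → ℝ) :
    Integrable (fun x => noiseDensity (y - A *ᵥ x)) P := by
  refine Integrable.of_bound (C := 1) ?_ (ae_of_all _ fun x => ?_)
  · have : Continuous fun x => noiseDensity (y - A *ᵥ x) := by fun_prop
    exact this.aestronglyMeasurable
  · rw [Real.norm_of_nonneg (noiseDensity_pos _).le]
    exact noiseDensity_le_one _

lemma continuous_outputDensity :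
    Continuous fun p : Matrix (Fin n) (Fin L) ℝ × (Fin n → ℝ) => outputDensity P p.1 p.2 := by
  have : FirstCountableTopology (Matrix (Fin n) (Fin L) ℝ) :=
    inferInstanceAs (FirstCountableTopology (Fin n → Fin L → ℝ))
  refine continuous_of_dominated (bound := fun _ => 1) (fun p => ?_) (fun p => ?_)
    (integrable_const _) (ae_of_all _ fun x => ?_)
  · exact (integrable_noiseDensity_sub P p.1 p.2).aestronglyMeasurable
  · refine ae_of_all _ fun x => ?_
    rw [Real.norm_of_nonneg (noiseDensity_pos _).le]
    exact noiseDensity_le_one _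
  · fun_prop

lemma outputDensity_pos (A : Matrix (Fin n) (Fin L) ℝ) (y : Fin n → ℝ) :
    0 < outputDensity P A y := by
  refine (integral_pos_iff_support_of_nonneg (fun x => (noiseDensity_pos _).le)
    (integrable_noiseDensity_sub P A y)).mpr ?_
  have : Function.support (fun x => noiseDensity (y - A *ᵥ x)) = Set.univ := by
    ext x
    simp [(noiseDensity_pos (y - A *ᵥ x)).ne']
  rw [this, measure_univ]
  exact one_pos

lemma log_outputDensity_nonpos (A : Matrix (Fin n) (Fin L) ℝ) (y : Fin n → ℝ) :
    Real.log (outputDensity P A y) ≤ 0 := by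
  refine Real.log_nonpos (outputDensity_pos P A y).le ?_
  calc outputDensity P A y ≤ ∫ _, (1 : ℝ) ∂P :=
        integral_mono (integrable_noiseDensity_sub P A y) (integrable_const _)
          fun x => noiseDensity_le_one _
    _ = 1 := by simp

/-- The squared Frobenius norm. -/
def frobSq (A : Matrix (Fin n) (Fin L) ℝ) : ℝ := ∑ i, ∑ k, A i k ^ 2

lemma frobSq_nonneg (A : Matrix (Fin n) (Fin L) ℝ) : 0 ≤ frobSq A :=
  Finset.sum_nonneg fun _ _ => Finset.sum_nonneg fun _ _ => sq_nonneg _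

lemma mulVec_dotProduct_self_le (A : Matrix (Fin n) (Fin L) ℝ) (x : Fin L → ℝ) :
    (A *ᵥ x) ⬝ᵥ (A *ᵥ x) ≤ frobSq A * (x ⬝ᵥ x) := by
  rw [frobSq, Finset.sum_mul]
  refine Finset.sum_le_sum fun i _ => ?_
  have := Finset.sum_mul_sq_le_sq_mul_sq Finset.univ (A i) x
  simpa only [mulVec, dotProduct, sq] using this

lemma dotProduct_add_self_le (u v : Fin n → ℝ) :
    (u + v) ⬝ᵥ (u + v) ≤ 2 * (u ⬝ᵥ u) + 2 * (v ⬝ᵥ v) := by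
  simp only [dotProduct, Finset.mul_sum, ← Finset.sum_add_distrib, Pi.add_apply]
  exact Finset.sum_le_sum fun i _ => by nlinarith [sq_nonneg (u i - v i)]

lemma dotProduct_sub_self_le (u v : Fin n → ℝ) :
    (u - v) ⬝ᵥ (u - v) ≤ 2 * (u ⬝ᵥ u) + 2 * (v ⬝ᵥ v) := by
  simp only [dotProduct, Finset.mul_sum, ← Finset.sum_add_distrib, Pi.sub_apply]
  exact Finset.sum_le_sum fun i _ => by nlinarith [sq_nonneg (u i + v i)]

variable {P} in
-- Jensen for `exp`, after bounding the exponent by `|y - Ax|² ≤ 2|y|² + 2|Ax|²`. The log-density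
-- thus falls at most quadratically, so second moments control it.
lemma le_log_outputDensity (hP : Integrable (fun x => x ⬝ᵥ x) P) (A : Matrix (Fin n) (Fin L) ℝ)
    (y : Fin n → ℝ) :
    logPeak n - y ⬝ᵥ y - frobSq A * ∫ x, x ⬝ᵥ x ∂P ≤ Real.log (outputDensity P A y) := by
  rw [Real.le_log_iff_exp_le (outputDensity_pos P A y)]
  set φ : (Fin L → ℝ) → ℝ := fun x => logPeak n - y ⬝ᵥ y - frobSq A * (x ⬝ᵥ x) with hφ
  have hφi : Integrable φ P := (integrable_const _).sub (hP.const_mul _)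
  have hle : ∀ x, Real.exp (φ x) ≤ noiseDensity (y - A *ᵥ x) := by
    intro x
    rw [noiseDensity_eq, Real.exp_le_exp]
    linarith [dotProduct_sub_self_le y (A *ᵥ x), mulVec_dotProduct_self_le A x]
  have hei : Integrable (fun x => Real.exp (φ x)) P := by
    refine (integrable_noiseDensity_sub P A y).mono ?_ (ae_of_all _ fun x => ?_)
    · exact Real.continuous_exp.comp_aestronglyMeasurable hφi.aestronglyMeasurable
    · rw [Real.norm_of_nonneg (Real.exp_pos _).le, Real.norm_of_nonneg (noiseDensity_pos _).le]
      exact hle x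
  have hj := convexOn_exp.map_integral_le (f := φ) (μ := P) Real.continuous_exp.continuousOn
    isClosed_univ (ae_of_all _ fun _ => Set.mem_univ _) hφi hei
  have hφint : ∫ x, φ x ∂P = logPeak n - y ⬝ᵥ y - frobSq A * ∫ x, x ⬝ᵥ x ∂P := by
    rw [hφ, integral_sub (integrable_const _) (hP.const_mul _), integral_const_mul]
    simp
  rw [← hφint]
  exact hj.trans (integral_mono hei (integrable_noiseDensity_sub P A y) hle)

/-- The information density at channel input `z.1` and noise `z.2`. -/
def infoDensity (A : Matrix (Fin n) (Fin L) ℝ) (z : (Fin L → ℝ) × (Fin n → ℝ)) : ℝ :=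
  Real.log (noiseDensity z.2) - Real.log (outputDensity P A (A *ᵥ z.1 + z.2))

lemma continuous_infoDensity :
    Continuous fun p : Matrix (Fin n) (Fin L) ℝ × ((Fin L → ℝ) × (Fin n → ℝ)) =>
      infoDensity P p.1 p.2 := by
  have h1 : Continuous fun p : Matrix (Fin n) (Fin L) ℝ × ((Fin L → ℝ) × (Fin n → ℝ)) =>
      noiseDensity p.2.2 := by fun_prop
  have h2 : Continuous fun p : Matrix (Fin n) (Fin L) ℝ × ((Fin L → ℝ) × (Fin n → ℝ)) =>
      (p.1, p.1 *ᵥ p.2.1 + p.2.2) := by fun_prop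
  have h3 := (continuous_outputDensity P).comp h2
  exact (h1.log fun p => (noiseDensity_pos _).ne').sub
    (h3.log fun p => (outputDensity_pos P _ _).ne')

variable {P}

/-- Stated with `R` rather than `frobSq A` so that one bound dominates for all matrices near a given
one. -/
lemma abs_infoDensity_le (hP : Integrable (fun x => x ⬝ᵥ x) P) (A : Matrix (Fin n) (Fin L) ℝ)
    {R : ℝ} (hR : frobSq A ≤ R) (z : (Fin L → ℝ) × (Fin n → ℝ)) :
    |infoDensity P A z| ≤
      (-2 * logPeak n + R * ∫ x, x ⬝ᵥ x ∂P) + 2 * R * (z.1 ⬝ᵥ z.1) + 3 * (z.2 ⬝ᵥ z.2) := by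
  have h1 := log_outputDensity_nonpos P A (A *ᵥ z.1 + z.2)
  have h2 := le_log_outputDensity hP A (A *ᵥ z.1 + z.2)
  have h3 := dotProduct_add_self_le (A *ᵥ z.1) z.2
  have h4 := mulVec_dotProduct_self_le A z.1
  have h5 := logPeak_nonpos n
  have h6 := dotProduct_self_nonneg' z.2
  have h7 : frobSq A * (z.1 ⬝ᵥ z.1) ≤ R * (z.1 ⬝ᵥ z.1) :=
    mul_le_mul_of_nonneg_right hR (dotProduct_self_nonneg' _)
  have h8 : frobSq A * ∫ x, x ⬝ᵥ x ∂P ≤ R * ∫ x, x ⬝ᵥ x ∂P :=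
    mul_le_mul_of_nonneg_right hR (integral_nonneg fun x => dotProduct_self_nonneg' x)
  have h9 : 0 ≤ frobSq A * (z.1 ⬝ᵥ z.1) := mul_nonneg (frobSq_nonneg A) (dotProduct_self_nonneg' _)
  have h10 : 0 ≤ frobSq A * ∫ x, x ⬝ᵥ x ∂P :=
    mul_nonneg (frobSq_nonneg A) (integral_nonneg fun x => dotProduct_self_nonneg' x)
  rw [infoDensity, log_noiseDensity, abs_le]
  constructor <;> linarith

lemma integrable_infoBound (hP : Integrable (fun x => x ⬝ᵥ x) P) (a b c : ℝ) :
    Integrable (fun z : (Fin L → ℝ) × (Fin n → ℝ) => a + b * (z.1 ⬝ᵥ z.1) + c * (z.2 ⬝ᵥ z.2))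
      (P.prod (stdNoise n)) :=
  ((integrable_const a).add ((hP.comp_fst (stdNoise n)).const_mul b)).add
    ((integrable_dotProduct_self_stdNoise.comp_snd P).const_mul c)

lemma integrable_infoDensity (hP : Integrable (fun x => x ⬝ᵥ x) P)
    (A : Matrix (Fin n) (Fin L) ℝ) : Integrable (infoDensity P A) (P.prod (stdNoise n)) := by
  refine (integrable_infoBound hP _ _ _).mono' ?_
    (ae_of_all _ fun z => abs_infoDensity_le hP A le_rfl z)
  exact ((continuous_infoDensity P).comp (Continuous.prodMk_right A)).aestronglyMeasurable

variable (P) in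
/-- The mutual information, in nats, between a channel input with law `P` and the output of the
Gaussian channel with matrix `A`. -/
def gaussianInfo (A : Matrix (Fin n) (Fin L) ℝ) : ℝ :=
  ∫ z, infoDensity P A z ∂(P.prod (stdNoise n))

/-- Integrating over input and noise, not input and output, keeps the measure independent of `A`, so
dominated convergence applies. -/
lemma continuous_gaussianInfo (hP : Integrable (fun x => x ⬝ᵥ x) P) :
    Continuous (gaussianInfo P : Matrix (Fin n) (Fin L) ℝ → ℝ) := by
  have : FirstCountableTopology (Matrix (Fin n) (Fin L) ℝ) :=
    inferInstanceAs (FirstCountableTopology (Fin n → Fin L → ℝ))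
  rw [continuous_iff_continuousAt]
  intro A₀
  have hf : Continuous (frobSq : Matrix (Fin n) (Fin L) ℝ → ℝ) := by
    unfold frobSq
    fun_prop
  have hev : ∀ᶠ A in nhds A₀, frobSq A ≤ frobSq A₀ + 1 :=
    (hf.continuousAt.eventually_lt continuousAt_const (lt_add_one _)).mono fun _ h => h.le
  refine continuousAt_of_dominated
    (Filter.Eventually.of_forall fun A => (integrable_infoDensity hP A).aestronglyMeasurable)
    (hev.mono fun A hA => ae_of_all _ fun z => abs_infoDensity_le hP A hA z)
    (integrable_infoBound hP _ _ _) (ae_of_all _ fun z => ?_)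
  exact ((continuous_infoDensity P).comp (Continuous.prodMk_left z)).continuousAt

variable (P) in
-- Rotating the noise by `Q` preserves the law of input and noise and carries the information
-- density of `A` to that of `Q * A`.
lemma gaussianInfo_orthogonal_mul (A : Matrix (Fin n) (Fin L) ℝ) (Q : Matrix (Fin n) (Fin n) ℝ)
    (hQ : Qᵀ * Q = 1) : gaussianInfo P (Q * A) = gaussianInfo P A := by
  have hm : Measurable fun w : Fin n → ℝ => Q *ᵥ w := by
    have : Continuous fun w : Fin n → ℝ => Q *ᵥ w := by fun_prop
    exact this.measurable
  have hinv := noiseDensity_mulVec Q hQ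
  have hout : ∀ y, outputDensity P (Q * A) (Q *ᵥ y) = outputDensity P A y := by
    intro y
    simp only [outputDensity, ← mulVec_mulVec, ← mulVec_sub, hinv]
  have hid : ∀ z, infoDensity P (Q * A) (Prod.map id (fun w => Q *ᵥ w) z) =
      infoDensity P A z := by
    intro z
    rw [infoDensity, infoDensity, Prod.map_fst, Prod.map_snd, hinv, id, ← mulVec_mulVec,
      ← mulVec_add, hout]
  have hmap : (P.prod (stdNoise n)).map (Prod.map id fun w => Q *ᵥ w) = P.prod (stdNoise n) := by
    rw [← Measure.map_prod_map _ _ measurable_id hm, Measure.map_id, map_mulVec_stdNoise Q hQ]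
  rw [gaussianInfo, ← hmap, integral_map (measurable_id.prodMap hm).aemeasurable]
  · simp only [hid]
    rfl
  · exact ((continuous_infoDensity P).comp (Continuous.prodMk_right (Q * A))).aestronglyMeasurable

end Output

end OutputDensity

/-! ### Mutual information as the Gaussian integral; compactness of the feasible set -/

section MutualInformation

variable {n L : ℕ}

/-- The joint law of input and output of the Gaussian channel with matrix `A`. -/
def jointLaw (P : Measure (Fin L → ℝ)) (A : Matrix (Fin n) (Fin L) ℝ) :
    Measure ((Fin L → ℝ) × (Fin n → ℝ)) :=
  (P.prod (stdNoise n)).map fun z => (z.1, A *ᵥ z.1 + z.2)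

lemma measurable_channel (A : Matrix (Fin n) (Fin L) ℝ) :
    Measurable fun z : (Fin L → ℝ) × (Fin n → ℝ) => (z.1, A *ᵥ z.1 + z.2) := by
  have : Continuous fun z : (Fin L → ℝ) × (Fin n → ℝ) => (z.1, A *ᵥ z.1 + z.2) := by fun_prop
  exact this.measurable

section

variable (P : Measure (Fin L → ℝ)) (A : Matrix (Fin n) (Fin L) ℝ)

lemma measurable_noiseDensity_sub :
    Measurable fun z : (Fin L → ℝ) × (Fin n → ℝ) =>
      ENNReal.ofReal (noiseDensity (z.2 - A *ᵥ z.1)) := by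
  have : Continuous fun z : (Fin L → ℝ) × (Fin n → ℝ) => noiseDensity (z.2 - A *ᵥ z.1) := by
    fun_prop
  exact this.measurable.ennreal_ofReal

/-- Given the input `x`, the output is the noise translated by `A *ᵥ x`. -/
lemma jointLaw_eq_withDensity_volume :
    jointLaw P A = (P.prod volume).withDensity
      fun z => ENNReal.ofReal (noiseDensity (z.2 - A *ᵥ z.1)) := by
  have hg := measurable_noiseDensity_sub A
  have hgm : Measurable fun w : Fin n → ℝ => ENNReal.ofReal (noiseDensity w) :=
    (continuous_noiseDensity.measurable).ennreal_ofReal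
  refine Measure.ext_of_lintegral _ fun φ hφ => ?_
  rw [jointLaw, lintegral_map hφ (measurable_channel A),
    lintegral_withDensity_eq_lintegral_mul _ hg hφ,
    lintegral_prod (fun z : (Fin L → ℝ) × (Fin n → ℝ) => φ (z.1, A *ᵥ z.1 + z.2))
      (hφ.comp (measurable_channel A)).aemeasurable,
    lintegral_prod _ (hg.mul hφ).aemeasurable]
  refine lintegral_congr fun x => ?_
  have h1 : Measurable fun w : Fin n → ℝ => φ (x, A *ᵥ x + w) := by fun_prop
  rw [stdNoise_eq_withDensity, lintegral_withDensity_eq_lintegral_mul _ hgm h1]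
  rw [← lintegral_sub_right_eq_self _ (A *ᵥ x)]
  simp

variable [IsProbabilityMeasure P]

lemma measurable_outputDensity : Measurable (outputDensity P A) :=
  ((continuous_outputDensity P).comp (Continuous.prodMk_right A)).measurable

lemma map_snd_jointLaw :
    (jointLaw P A).map Prod.snd = volume.withDensity
      fun y => ENNReal.ofReal (outputDensity P A y) := by
  have hg := measurable_noiseDensity_sub A
  refine Measure.ext_of_lintegral _ fun φ hφ => ?_
  have hφ' : Measurable fun z : (Fin L → ℝ) × (Fin n → ℝ) => φ z.2 := hφ.comp measurable_snd
  have hm : Measurable fun z : (Fin L → ℝ) × (Fin n → ℝ) =>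
      ENNReal.ofReal (noiseDensity (z.2 - A *ᵥ z.1)) * φ z.2 := hg.mul hφ'
  have h1 : ∫⁻ y, φ y ∂((jointLaw P A).map Prod.snd) =
      ∫⁻ z, ENNReal.ofReal (noiseDensity (z.2 - A *ᵥ z.1)) * φ z.2 ∂(P.prod volume) := by
    rw [lintegral_map hφ measurable_snd, jointLaw_eq_withDensity_volume]
    exact lintegral_withDensity_eq_lintegral_mul _ hg hφ'
  rw [h1, lintegral_prod_symm _ hm.aemeasurable,
    lintegral_withDensity_eq_lintegral_mul _ (measurable_outputDensity P A).ennreal_ofReal hφ]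
  refine lintegral_congr fun y => ?_
  have hy : Measurable fun x : Fin L → ℝ => ENNReal.ofReal (noiseDensity (y - A *ᵥ x)) :=
    (show Continuous fun x : Fin L → ℝ => noiseDensity (y - A *ᵥ x) by
      fun_prop).measurable.ennreal_ofReal
  change ∫⁻ x, ENNReal.ofReal (noiseDensity (y - A *ᵥ x)) * φ y ∂P =
    ENNReal.ofReal (outputDensity P A y) * φ y
  rw [ lintegral_mul_const _ hy, outputDensity,
    ofReal_integral_eq_lintegral_ofReal (integrable_noiseDensity_sub P A y)
      (ae_of_all _ fun x => (noiseDensity_pos _).le)]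

/-- The likelihood ratio of the joint law and the product of the marginals. -/
lemma jointLaw_eq_withDensity :
    jointLaw P A = (P.prod ((jointLaw P A).map Prod.snd)).withDensity fun z =>
      ENNReal.ofReal (noiseDensity (z.2 - A *ᵥ z.1) / outputDensity P A z.2) := by
  have hg := measurable_noiseDensity_sub A
  have hf := measurable_outputDensity P A
  have hg' : Measurable fun z : (Fin L → ℝ) × (Fin n → ℝ) => noiseDensity (z.2 - A *ᵥ z.1) := by
    have : Continuous fun z : (Fin L → ℝ) × (Fin n → ℝ) => noiseDensity (z.2 - A *ᵥ z.1) := by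
      fun_prop
    exact this.measurable
  have hq : Measurable fun z : (Fin L → ℝ) × (Fin n → ℝ) =>
      ENNReal.ofReal (noiseDensity (z.2 - A *ᵥ z.1) / outputDensity P A z.2) :=
    (hg'.div (hf.comp measurable_snd)).ennreal_ofReal
  rw [map_snd_jointLaw]
  have : SFinite ((volume : Measure (Fin n → ℝ)).withDensity
    fun y => ENNReal.ofReal (outputDensity P A y)) := inferInstance
  rw [prod_withDensity_right hf.ennreal_ofReal,
    ← withDensity_mul _ (f := fun z : (Fin L → ℝ) × (Fin n → ℝ) =>
      ENNReal.ofReal (outputDensity P A z.2)) (hf.ennreal_ofReal.comp measurable_snd) hq,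
    jointLaw_eq_withDensity_volume]
  congr 1
  funext z
  have hp := outputDensity_pos P A z.2
  simp only [Pi.mul_apply]
  rw [← ENNReal.ofReal_mul hp.le, mul_div_cancel₀ _ hp.ne']

instance : IsProbabilityMeasure (jointLaw P A) :=
  Measure.isProbabilityMeasure_map (measurable_channel A).aemeasurable

variable {P} in
lemma klDiv_jointLaw (hP : Integrable (fun x => x ⬝ᵥ x) P) :
    InformationTheory.klDiv (jointLaw P A) (P.prod ((jointLaw P A).map Prod.snd)) =
      ENNReal.ofReal (gaussianInfo P A) := by
  have hf := measurable_outputDensity P A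
  have hg' : Measurable fun z : (Fin L → ℝ) × (Fin n → ℝ) => noiseDensity (z.2 - A *ᵥ z.1) := by
    have : Continuous fun z : (Fin L → ℝ) × (Fin n → ℝ) => noiseDensity (z.2 - A *ᵥ z.1) := by
      fun_prop
    exact this.measurable
  have hq' : Measurable fun z : (Fin L → ℝ) × (Fin n → ℝ) =>
      noiseDensity (z.2 - A *ᵥ z.1) / outputDensity P A z.2 := hg'.div (hf.comp measurable_snd)
  have : IsProbabilityMeasure ((jointLaw P A).map Prod.snd) :=
    Measure.isProbabilityMeasure_map measurable_snd.aemeasurable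
  set ν := P.prod ((jointLaw P A).map Prod.snd) with hν
  have hac : jointLaw P A ≪ ν := by
    rw [jointLaw_eq_withDensity P A]
    exact withDensity_absolutelyContinuous _ _
  have hrn : (jointLaw P A).rnDeriv ν =ᵐ[ν] fun z =>
      ENNReal.ofReal (noiseDensity (z.2 - A *ᵥ z.1) / outputDensity P A z.2) := by
    have := Measure.rnDeriv_withDensity ν hq'.ennreal_ofReal
    rwa [hν, ← jointLaw_eq_withDensity P A] at this
  set ℓ : (Fin L → ℝ) × (Fin n → ℝ) → ℝ := fun z =>
    Real.log (noiseDensity (z.2 - A *ᵥ z.1) / outputDensity P A z.2) with hℓ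
  have hllr : llr (jointLaw P A) ν =ᵐ[jointLaw P A] ℓ := by
    filter_upwards [hac.ae_le hrn] with z hz
    rw [llr, hz, ENNReal.toReal_ofReal
      (div_nonneg (noiseDensity_pos _).le (outputDensity_pos P A _).le)]
  have hℓm : Measurable ℓ := hq'.log
  have hcomp : (ℓ ∘ fun z => (z.1, A *ᵥ z.1 + z.2)) = infoDensity P A := by
    funext z
    simp only [hℓ, Function.comp, infoDensity, add_sub_cancel_left]
    rw [Real.log_div (noiseDensity_pos _).ne' (outputDensity_pos P A _).ne']
  have hint : Integrable ℓ (jointLaw P A) := by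
    rw [jointLaw, integrable_map_measure hℓm.aestronglyMeasurable
      (measurable_channel A).aemeasurable, hcomp]
    exact integrable_infoDensity hP A
  rw [InformationTheory.klDiv_of_ac_of_integrable hac ((integrable_congr hllr).mpr hint),
    integral_congr_ae hllr]
  -- The total-mass correction in `klDiv` cancels between two probability measures.
  simp only [probReal_univ, add_sub_cancel_right]
  rw [jointLaw, integral_map (measurable_channel A).aemeasurable hℓm.aestronglyMeasurable,
    gaussianInfo, ← hcomp]
  rfl

end

lemma mutualInfo_eq_gaussianInfo {Ω : Type*} [MeasurableSpace Ω] {μ : Measure Ω}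
    [IsProbabilityMeasure μ] {s : Ω → Fin L → ℝ} {w : Ω → Fin n → ℝ} (hs : Measurable s)
    (hw : Measurable w) (hw_law : μ.map w = stdNoise n) (hsw : IndepFun s w μ)
    (hP : Integrable (fun x => x ⬝ᵥ x) (μ.map s)) (A : Matrix (Fin n) (Fin L) ℝ) :
    mutualInfo μ s (fun ω => A *ᵥ s ω + w ω) = ENNReal.ofReal (gaussianInfo (μ.map s) A) := by
  have : IsProbabilityMeasure (μ.map s) := Measure.isProbabilityMeasure_map hs.aemeasurable
  have hprod : μ.map (fun ω => (s ω, w ω)) = (μ.map s).prod (stdNoise n) := by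
    rw [(indepFun_iff_map_prod_eq_prod_map_map hs.aemeasurable hw.aemeasurable).mp hsw, hw_law]
  have hjoint : μ.map (fun ω => (s ω, A *ᵥ s ω + w ω)) = jointLaw (μ.map s) A := by
    rw [jointLaw, ← hprod, Measure.map_map (measurable_channel A) (hs.prodMk hw)]
    rfl
  have hout : μ.map (fun ω => A *ᵥ s ω + w ω) = (jointLaw (μ.map s) A).map Prod.snd := by
    have hm : Measurable fun ω => (s ω, A *ᵥ s ω + w ω) :=
      (measurable_channel A).comp (hs.prodMk hw)
    rw [← hjoint, Measure.map_map measurable_snd hm]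
    rfl
  rw [mutualInfo, hjoint, hout, klDiv_jointLaw A hP]

lemma integrable_dotProduct_self_of_power {Ω : Type*} [MeasurableSpace Ω] {μ : Measure Ω}
    {s : Ω → Fin L → ℝ} (hs : Measurable s)
    (hpow : ∀ k l : Fin L, ∫ ω, s ω k * s ω l ∂μ = if k = l then 1 else 0) :
    Integrable (fun x => x ⬝ᵥ x) (μ.map s) := by
  have hc : Continuous fun x : Fin L → ℝ => x ⬝ᵥ x := by fun_prop
  rw [integrable_map_measure hc.aestronglyMeasurable hs.aemeasurable]
  -- A non-integrable function has integral `0` by convention, so the value `1` forces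
  -- integrability.
  have hk : ∀ k, Integrable (fun ω => s ω k * s ω k) μ := fun k =>
    Integrable.of_integral_ne_zero (by rw [hpow k k]; simp)
  simpa only [Function.comp_def, dotProduct] using integrable_finsetSum Finset.univ fun k _ => hk k

/-! ### The optimization problem -/

section Optimization

variable {N J m : ℕ}

lemma isFeasible_mono {Ts : ℝ} (hTs : 0 < Ts) {e : Fin J → Fin N} {E : Fin J → ℝ}
    {B B' : Fin N → Matrix (Fin m) (Fin L) ℝ} (hB : IsFeasible Ts e E B)
    (h : ∀ i, (B' i * (B' i)ᵀ).trace ≤ (B i * (B i)ᵀ).trace) : IsFeasible Ts e E B' := fun l =>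
  (mul_le_mul_of_nonneg_left (Finset.sum_le_sum fun _ _ => Finset.sum_le_sum fun i _ => h i)
    hTs.le).trans (hB l)

/-- Take the last index whose packet has arrived; one exists because the first arrives at the start.
Every precoder is thereby subject to an energy constraint. -/
lemma exists_mem_pool [NeZero N] [NeZero J] (e : Fin J → Fin N) (he0 : e 0 = 0) (i : Fin N) :
    ∃ j, i ∈ pool e j := by
  have hne : (Finset.univ.filter fun j => e j ≤ i).Nonempty :=
    ⟨0, by simp [he0]⟩
  refine ⟨Finset.max' _ hne, ?_⟩
  have h1 := Finset.max'_mem _ hne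
  rw [Finset.mem_filter] at h1
  rw [pool, Finset.mem_filter]
  refine ⟨Finset.mem_univ _, h1.2, fun k hk => ?_⟩
  by_contra hc
  exact absurd (Finset.le_max' _ k (by simpa using hc)) (not_le.mpr hk)

lemma trace_mul_transpose_self (B : Matrix (Fin m) (Fin L) ℝ) :
    (B * Bᵀ).trace = ∑ i, ∑ k, B i k * B i k := by
  simp [trace, mul_apply]

lemma trace_mul_transpose_self_nonneg (B : Matrix (Fin m) (Fin L) ℝ) : 0 ≤ (B * Bᵀ).trace := by
  rw [trace_mul_transpose_self]
  exact Finset.sum_nonneg fun _ _ => Finset.sum_nonneg fun _ _ => mul_self_nonneg _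

lemma isCompact_isFeasible [NeZero N] [NeZero J] {Ts : ℝ} (hTs : 0 < Ts) {e : Fin J → Fin N}
    (he0 : e 0 = 0) (E : Fin J → ℝ) :
    IsCompact {B : Fin N → Matrix (Fin m) (Fin L) ℝ | IsFeasible Ts e E B} := by
  have hclosed : IsClosed {B : Fin N → Matrix (Fin m) (Fin L) ℝ | IsFeasible Ts e E B} := by
    simp only [IsFeasible, Set.ofPred_forall]
    refine isClosed_iInter fun l => isClosed_le ?_ continuous_const
    fun_prop
  set R : ℝ := (∑ j, E j) / Ts with hR
  have hbound : ∀ B : Fin N → Matrix (Fin m) (Fin L) ℝ, IsFeasible Ts e E B →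
      ∀ i a k, B i a k ∈ Set.Icc (-(R + 1)) (R + 1) := by
    intro B hB i a k
    obtain ⟨j, hj⟩ := exists_mem_pool e he0 i
    have hlast : ∀ j : Fin J, j ≤ ⟨J - 1, Nat.sub_lt (NeZero.pos J) one_pos⟩ := fun j => by
      rw [Fin.le_def]
      have := j.isLt
      simp only
      omega
    -- The last constraint covers all pools, so it bounds every single precoder.
    have h1 := hB ⟨J - 1, Nat.sub_lt (NeZero.pos J) one_pos⟩
    have hIic : Finset.Iic (⟨J - 1, Nat.sub_lt (NeZero.pos J) one_pos⟩ : Fin J) = Finset.univ := by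
      ext j
      simp [hlast j]
    rw [hIic] at h1
    have h2 : (B i * (B i)ᵀ).trace ≤ ∑ j, ∑ i ∈ pool e j, (B i * (B i)ᵀ).trace :=
      (Finset.single_le_sum (f := fun i => (B i * (B i)ᵀ).trace)
        (fun i _ => trace_mul_transpose_self_nonneg _) hj).trans
        (Finset.single_le_sum (f := fun j => ∑ i ∈ pool e j, (B i * (B i)ᵀ).trace)
          (fun j _ => Finset.sum_nonneg fun i _ => trace_mul_transpose_self_nonneg _)
          (Finset.mem_univ j))
    have h3 : (B i * (B i)ᵀ).trace ≤ R := by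
      rw [hR, le_div_iff₀ hTs]
      calc _ ≤ _ := mul_le_mul_of_nonneg_right h2 hTs.le
        _ ≤ _ := by rw [mul_comm]; exact h1
    have h4 : B i a k * B i a k ≤ R := by
      refine le_trans ?_ h3
      rw [trace_mul_transpose_self]
      exact (Finset.single_le_sum (f := fun k => B i a k * B i a k)
        (fun k _ => mul_self_nonneg _) (Finset.mem_univ k)).trans
        (Finset.single_le_sum (f := fun a => ∑ k, B i a k * B i a k)
          (fun a _ => Finset.sum_nonneg fun k _ => mul_self_nonneg _) (Finset.mem_univ a))
    have h5 : 0 ≤ R := (mul_self_nonneg _).trans h4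
    -- From `x * x ≤ R` one gets `|x| ≤ R + 1`; the added `1` avoids a square root.
    exact ⟨by nlinarith, by nlinarith⟩
  have hK : IsCompact (Set.univ.pi fun _ : Fin N => Set.univ.pi fun _ : Fin m =>
      Set.univ.pi fun _ : Fin L => Set.Icc (-(R + 1)) (R + 1)) :=
    isCompact_univ_pi fun _ => isCompact_univ_pi fun _ => isCompact_univ_pi fun _ => isCompact_Icc
  exact hK.of_isClosed_subset hclosed fun B hB i _ a _ k _ => hbound B hB i a k

end Optimization

end MutualInformation

end EnergyHarvesting

end

theorem mainTheorem3 {Ω : Type*} [MeasurableSpace Ω] (μ : Measure Ω) [IsProbabilityMeasure μ]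
    (N J nT nR L : ℕ) [NeZero N] [NeZero J]
    -- the symbols: i.i.d. along channel uses, independent components, unit power
    (s : Fin N → Ω → Fin L → ℝ) (hs : ∀ n, Measurable (s n))
    (PS : Measure (Fin L → ℝ)) (hs_law : ∀ n, μ.map (s n) = PS)
    (hs_comp : ∀ n, iIndepFun (fun (k : Fin L) (ω : Ω) => s n ω k) μ)
    (hs_power : ∀ n (k l : Fin L), ∫ ω, s n ω k * s n ω l ∂μ = if k = l then 1 else 0)
    -- the noise: standard Gaussian, independent of the symbol; independent channel uses
    (w : Fin N → Ω → Fin nR → ℝ) (hw : ∀ n, Measurable (w n))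
    (hw_law : ∀ n, μ.map (w n) = Measure.pi (fun _ : Fin nR => gaussianReal 0 1))
    (hsw : ∀ n, IndepFun (s n) (w n) μ)
    (h_indep : iIndepFun (fun (n : Fin N) (ω : Ω) => (s n ω, w n ω)) μ)
    -- the channels: full rank
    (H : Fin N → Matrix (Fin nR) (Fin nT) ℝ)
    (hH : ∀ n, (H n).rank = min nT nR) (hL : L ≤ min nT nR)
    -- the energy harvesting process
    (Ts : ℝ) (hTs : 0 < Ts) (e : Fin J → Fin N) (he : Monotone e) (he0 : e 0 = 0)
    (E : Fin J → ℝ) (hE : ∀ j, 0 ≤ E j)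
    -- eigenvectors of the channel Gram matrices
    (U : Fin N → Matrix (Fin nT) (Fin L) ℝ)
    (hU : ∀ n, EnergyHarvesting.IsTopEigenvectors ((H n)ᵀ * H n) (U n)) :
    (∃ B : Fin N → Matrix (Fin nT) (Fin L) ℝ,
      EnergyHarvesting.IsOptimal μ s w H Ts e E B ∧
      ∀ n, EnergyHarvesting.HasLeftSingularVectors (B n) (U n)) ∧
    ∀ B : Fin N → Matrix (Fin nT) (Fin L) ℝ,
      EnergyHarvesting.IsOptimal μ s w H Ts e E B →
      ∃ B' : Fin N → Matrix (Fin nT) (Fin L) ℝ,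
        EnergyHarvesting.IsOptimal μ s w H Ts e E B' ∧
        (∀ n, EnergyHarvesting.HasLeftSingularVectors (B' n) (U n)) ∧
        ∀ n,
          EnergyHarvesting.mutualInfo μ (s n)
              (EnergyHarvesting.received (H n) (B' n) (s n) (w n)) =
            EnergyHarvesting.mutualInfo μ (s n)
              (EnergyHarvesting.received (H n) (B n) (s n) (w n)) ∧
          (B' n * (B' n)ᵀ).trace ≤ (B n * (B n)ᵀ).trace := by
  open EnergyHarvesting in
  have hprob : ∀ n, IsProbabilityMeasure (μ.map (s n)) := fun n =>
    Measure.isProbabilityMeasure_map (hs n).aemeasurable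
  have hP : ∀ n, Integrable (fun x => x ⬝ᵥ x) (μ.map (s n)) := fun n =>
    integrable_dotProduct_self_of_power (hs n) (hs_power n)
  have hinfo : ∀ n (B : Matrix (Fin nT) (Fin L) ℝ),
      mutualInfo μ (s n) (received (H n) B (s n) (w n)) =
        ENNReal.ofReal (gaussianInfo (μ.map (s n)) (H n * B)) := fun n B =>
    mutualInfo_eq_gaussianInfo (hs n) (hw n) (hw_law n) (hsw n) (hP n) (H n * B)
  have hreplace : ∀ B : Fin N → Matrix (Fin nT) (Fin L) ℝ, IsOptimal μ s w H Ts e E B →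
      ∃ B' : Fin N → Matrix (Fin nT) (Fin L) ℝ, IsOptimal μ s w H Ts e E B' ∧
        (∀ n, HasLeftSingularVectors (B' n) (U n)) ∧
        ∀ n, mutualInfo μ (s n) (received (H n) (B' n) (s n) (w n)) =
            mutualInfo μ (s n) (received (H n) (B n) (s n) (w n)) ∧
          (B' n * (B' n)ᵀ).trace ≤ (B n * (B n)ᵀ).trace := by
    intro B hB
    have hG : ∀ n, ((H n)ᵀ * H n).PosSemidef := fun n => by
      have := posSemidef_conjTranspose_mul_self (H n)
      rwa [conjTranspose_eq_transpose_of_trivial] at this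
    choose B' hB'1 hB'2 hB'3 using fun n => exists_hasLeftSingularVectors (hG n)
      (by rw [rank_transpose_mul_self, hH]; exact hL) (hU n) (B n)
    have heq : ∀ n, mutualInfo μ (s n) (received (H n) (B' n) (s n) (w n)) =
        mutualInfo μ (s n) (received (H n) (B n) (s n) (w n)) := by
      intro n
      -- Equality of the `HᵀH`-Gram matrices is equality of the Gram matrices of `H n * B n` and `H
      -- n * B' n`.
      obtain ⟨Q, hQ, hQB⟩ := exists_orthogonal_mul_eq (H n * B n) (H n * B' n) (by
        have := (hB'2 n).symm
        simpa only [transpose_mul, Matrix.mul_assoc] using this)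
      rw [hinfo, hinfo, hQB, gaussianInfo_orthogonal_mul _ _ Q hQ]
    have htot : totalInfo μ s w H e B' = totalInfo μ s w H e B := by
      simp only [totalInfo, heq]
    refine ⟨B', ⟨isFeasible_mono hTs hB.1 hB'3, fun C hC => ?_⟩, hB'1, fun n => ⟨heq n, hB'3 n⟩⟩
    rw [htot]
    exact hB.2 C hC
  refine ⟨?_, hreplace⟩
  have hcont : Continuous (totalInfo μ s w H e) := by
    unfold totalInfo
    simp only [hinfo]
    refine continuous_finsetSum _ fun j _ => continuous_finsetSum _ fun n _ => ?_
    have h1 : Continuous fun B : Fin N → Matrix (Fin nT) (Fin L) ℝ => H n * B n := by fun_prop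
    exact ENNReal.continuous_ofReal.comp ((continuous_gaussianInfo (hP n)).comp h1)
  -- The zero precoder is feasible because the packets are nonnegative.
  obtain ⟨B, hB, hmax⟩ := (isCompact_isFeasible (m := nT) (L := L) hTs he0 E).exists_isMaxOn
    ⟨0, fun l => by simpa using Finset.sum_nonneg fun j _ => hE j⟩ hcont.continuousOn
  obtain ⟨B', hB'1, hB'2, -⟩ := hreplace B ⟨hB, fun C hC => hmax hC⟩
  exact ⟨B', hB'1, hB'2⟩
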